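/- Let $1 \le k < d$ be integers, let $G=(V,E)$ be a finite simple graph, and let $p,q : V \to \mathbb{R}^d$ be realisations of $G$. Write $p_i : V \to \mathbb{R}$ for the $i$-th coordinate of $p$ and $\tilde p = (p_1,\dots,p_{d-k}) : V \to \mathbb{R}^{d-k}$. Definitions. $(G,p)$ is generic if the coordinates $p_i(v)$ ($v\in V$, $1\le i\le d$) are distinct and algebraically independent over $\mathbb{Q}$. $(G,p)$ and $(G,q)$ are $(d,k)$-equivalent if $\|p(v)-p(w)\|=\|q(v)-q(w)\|$ for all $vw\in E$ and for each $i\in\{d-k+1,\dots,d\}$ there is a scalar $\beta_i\ne 0$ with $p_i=\beta_i q_i$. The rigidity matrix $R(G,p)$ is the $|E|\times d|V|$ matrix whose row indexed by $vw\in E$ has $p(v)-p(w)$ in the columns of $v$, $p(w)-p(v)$ in the columns of $w$, and zeros elsewhere. $DR_k(G,p)$ is the $|E|\times((d-k)|V|+k)$ matrix obtained from $R(G,\tilde p)$ by appending, for each $i\in\{d-k+1,\dots,d\}$, the column $\big((p_i(v)-p_i(w))^2\big)_{vw\in E}$. For $v_0\in V$ with $p_i(v_0)\neq 0$ for all $i\in\{d-k+1,\dots,d\}$,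 $J_{v_0}(G,p)$ is the $(|E|+k(|V|-1))\times d|V|$ matrix obtained from $R(G,p)$ by appending one row for each $v\in V\setminus\{v_0\}$ and $i\in\{d-k+1,\dots,d\}$, with entry $1/p_i(v_0)$ in column $(v,i)$, entry $-p_i(v)/p_i(v_0)^2$ in column $(v_0,i)$, and zeros elsewhere. $(G,p)$ is $(d,k)$-rigid if either $G$ is complete and $\{p(v):v\in V\}$ has affine dimension $\min\{d,|V|-1\}$, or $G$ is not complete and $\operatorname{rank}J_{v_0}(G,p)=d|V|-\binom{d-k+1}{2}$ for some $v_0 \in V$ with $p_i(v_0)\ne0$ for all $i\in\{d-k+1,\dots,d\}$. Lemma. Suppose that $(G,p)$ is generic and $(d,k)$-rigid and that $(G,q)$ is $(d,k)$-equivalent to $(G,p)$. Then $\ker DR_k(G,p)^T=\ker DR_k(G,q)^T$, and $\ker J_{v_0}(G,p)^T=\ker J_{v_0}(G,q)^T$ for every $v_0\in V$. Furthermore, if $\sigma\in\ker DR_k(G,p)^T$, $i\in\{d-k+1,\dots,d\}$ and $\alpha_i \in \mathbb{R}$ satisfies $q_i=\alpha_i p_i$, then for every $v\in V$ $$(1-\alpha_i^2)\sum_{w\in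 N_G(v)}\sigma(vw)\,\big(p_i(v)-p_i(w)\big)=0,$$ where $N_G(v)$ is the set of neighbours of $v$ in $G$. -/

import Mathlib

namespace DilationRigidity

variable {V : Type*}

/-- A realisation of a vertex set `V` in Euclidean `d`-space. -/
abbrev Realisation (V : Type*) (d : ℕ) : Type _ := V → EuclideanSpace ℝ (Fin d)

/-- The last `k` coordinates of `ℝ^d` (the coordinates `d-k+1, …, d` in 1-based numbering). -/
abbrev DilCoord (d k : ℕ) : Type := {i : Fin d // d - k ≤ (i : ℕ)}

/-- A realisation is generic if the family of all its coordinates is algebraically independent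
over `ℚ` (for a family, this includes that the coordinates are distinct). -/
def IsGeneric {d : ℕ} (p : Realisation V d) : Prop :=
  AlgebraicIndependent ℚ (fun x : V × Fin d => p x.1 x.2)

/-- The frameworks `(G,p)` and `(G,q)` are equivalent: corresponding edges have equal length. -/
def Equivalent {d : ℕ} (G : SimpleGraph V) (p q : Realisation V d) : Prop :=
  ∀ v w : V, G.Adj v w → ‖p v - p w‖ = ‖q v - q w‖

/-- The frameworks `(G,p)` and `(G,q)` are `(d,k)`-equivalent: they are equivalent, and in each of
the last `k` coordinates `p` is a non-zero dilation of `q`. -/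
def DKEquivalent {d : ℕ} (k : ℕ) (G : SimpleGraph V) (p q : Realisation V d) : Prop :=
  Equivalent G p q ∧
    ∀ i : DilCoord d k, ∃ α : ℝ, α ≠ 0 ∧ ∀ v : V, p v i = α * q v i

/-- The projection of a realisation to the first `d - k` coordinates. -/
noncomputable def proj {d : ℕ} (k : ℕ) (p : Realisation V d) : Realisation V (d - k) :=
  fun v => WithLp.toLp 2 (fun j : Fin (d - k) => p v (Fin.castLE (Nat.sub_le d k) j))

/-- The rigidity matrix: the row of an edge `vw` has `p(v) - p(w)` in the columns of `v`,
`p(w) - p(v)` in the columns of `w`, and zeros elsewhere. -/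
noncomputable def rigidityMatrix [DecidableEq V] {m : ℕ} (G : SimpleGraph V)
    (p : Realisation V m) : Matrix G.edgeSet (V × Fin m) ℝ :=
  Matrix.of fun e x =>
    Sym2.lift ⟨fun v w : V =>
      (if x.1 = v then p v x.2 - p w x.2 else 0) + (if x.1 = w then p w x.2 - p v x.2 else 0),
      fun _ _ => add_comm _ _⟩ e.1

/-- The one-dimensional squared rigidity map: the squared lengths of the edges. -/
noncomputable def rigidityMap (G : SimpleGraph V) (x : V → ℝ) : G.edgeSet → ℝ :=
  fun e => Sym2.lift ⟨fun v w : V => (x v - x w) ^ 2, fun v w => by ring⟩ e.1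

/-- The block-diagonal matrix with blocks `M_{d-k+1}, …, M_d`, preceded by zero columns for the
first `d-k` coordinates.  The block `M_i` has rows indexed by `V \ {v₀}`, columns indexed by `V`,
and is the Jacobian of `p_i ↦ (p_i(v) / p_i(v₀))_v`. -/
noncomputable def dilationMatrix [DecidableEq V] {d : ℕ} (k : ℕ) (v₀ : V)
    (p : Realisation V d) : Matrix ({v : V // v ≠ v₀} × DilCoord d k) (V × Fin d) ℝ :=
  Matrix.of fun r x =>
    if x.2 = r.2.1 then
      (if x.1 = r.1.1 then 1 / p v₀ r.2.1
       else if x.1 = v₀ then -p r.1.1 r.2.1 / (p v₀ r.2.1) ^ 2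
       else 0)
    else 0

/-- The matrix `J_{v₀}(G,p)`: the rigidity matrix of `(G,p)` on top of the dilation matrix. -/
noncomputable def jacobian [DecidableEq V] {d : ℕ} (k : ℕ) (v₀ : V) (G : SimpleGraph V)
    (p : Realisation V d) :
    Matrix (G.edgeSet ⊕ ({v : V // v ≠ v₀} × DilCoord d k)) (V × Fin d) ℝ :=
  Matrix.fromRows (rigidityMatrix G p) (dilationMatrix k v₀ p)

/-- The matrix `DR_k(G,p)`: the rigidity matrix of the projected framework, extended by the `k`
columns of squared edge lengths in the last `k` coordinates. -/
noncomputable def dilRigidityMatrix [DecidableEq V] {d : ℕ} (k : ℕ) (G : SimpleGraph V)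
    (p : Realisation V d) : Matrix G.edgeSet ((V × Fin (d - k)) ⊕ DilCoord d k) ℝ :=
  Matrix.fromCols (rigidityMatrix G (proj k p))
    (Matrix.of fun e i => rigidityMap G (fun v => p v i) e)

/-- (Infinitesimal) `(d,k)`-rigidity of a framework: either `G` is complete and the points `p(v)`
have affine dimension `min {d, |V| - 1}`, or `G` is not complete and `J_{v₀}(G,p)` has rank
`d|V| - (d-k+1 choose 2)`, where `v₀` is a vertex at which the matrix is well defined. -/
def IsDKRigid [Fintype V] [DecidableEq V] {d : ℕ} (k : ℕ) (G : SimpleGraph V)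
    (p : Realisation V d) : Prop :=
  (G = ⊤ ∧ Module.finrank ℝ (vectorSpan ℝ (Set.range p)) = min d (Fintype.card V - 1)) ∨
  (G ≠ ⊤ ∧ ∃ v₀ : V, (∀ i : DilCoord d k, p v₀ i ≠ 0) ∧
    (jacobian k v₀ G p).rank + (d - k + 1).choose 2 = d * Fintype.card V)

/-- The kernel of the transpose of a matrix. -/
abbrev kerTranspose {m n : Type*} [Fintype m] (A : Matrix m n ℝ) : Submodule ℝ (m → ℝ) :=
  LinearMap.ker (Matrix.mulVecLin A.transpose)

end DilationRigidity

namespace DilationRigidity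

open MvPolynomial Matrix

/-! ### Extending derivations from an algebraically independent family. -/

section Derivations

/-! Genericity turns each infinitesimal motion `x` of `p` into a `ℚ`-derivation `D` of `ℝ` with `D
(p v i) = x (v, i)` (`exists_derivation_of_algebraicIndependent`). Applying `D` to the equations
relating `p` and `q` shows that every vector in the column space of the matrix at `p` lies in the
column space of the matrix at `q`. A generic point has maximal rank (`rank_map_aeval_le`), so the
two column spaces coincide, and hence so do the left kernels.

For the last claim, a stress in the left kernel of `DR_k` at `p` extends, by explicit multipliers,
to the left kernel of the Jacobian (`sumElim_mem_kerTranspose_jacobian`). The same vector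
annihilates the Jacobian at `q`. In column `(v, i)` the rigidity part scales by `α` and the dilation
part by `1 / α`, and comparing the two gives the factor `1 - α ^ 2`. -/

theorem exists_derivation_extending {R S T : Type*} [CommRing R] [CommRing S] [CommRing T]
    [Algebra R S] [Algebra R T] [Algebra S T] [IsScalarTower R S T] [Algebra.FormallyEtale S T]
    (δ : Derivation R S T) : ∃ D : Derivation R T T, ∀ s, D (algebraMap S T s) = δ s := by
  -- Formal étaleness identifies the differentials of `T` with the base change of those of `S`, so a
  -- linear map on the latter extends.
  have hb := KaehlerDifferential.isBaseChange_of_formallyEtale R S T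
  refine ⟨(hb.lift δ.liftKaehlerDifferential).compDer (KaehlerDifferential.D R T), fun s => ?_⟩
  have h := hb.lift_eq δ.liftKaehlerDifferential (KaehlerDifferential.D R S s)
  simpa using h

open scoped IntermediateField.algebraAdjoinAdjoin in
-- The extension is a localization (to the fraction field) followed by an algebraic extension,
-- separable in characteristic zero.
theorem formallyEtale_adjoin_of_isTranscendenceBasis {K L ι : Type*} [Field K] [CharZero K]
    [Field L] [Algebra K L] {b : ι → L} (hb : IsTranscendenceBasis K b) :
    Algebra.FormallyEtale (Algebra.adjoin K (Set.range b)) L := by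
  have : CharZero L := charZero_of_injective_algebraMap (algebraMap K L).injective
  have : Algebra.FormallyEtale (Algebra.adjoin K (Set.range b))
      (IntermediateField.adjoin K (Set.range b)) :=
    .of_isLocalization (nonZeroDivisors _)
  have : Algebra.IsAlgebraic (IntermediateField.adjoin K (Set.range b)) L :=
    hb.isAlgebraic_field
  have : Algebra.FormallyEtale (IntermediateField.adjoin K (Set.range b)) L :=
    Algebra.FormallyEtale.of_isSeparable _ L
  exact .comp _ (IntermediateField.adjoin K (Set.range b)) _

/-- On a field of characteristic zero a derivation can be prescribed freely on an algebraically
independent family. -/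
theorem exists_derivation_of_algebraicIndependent {K L ι : Type*} [Field K] [CharZero K] [Field L]
    [Algebra K L] {p : ι → L} (hp : AlgebraicIndependent K p) (x : ι → L) :
    ∃ D : Derivation K L L, ∀ i, D (p i) = x i := by
  obtain ⟨t, hst, ht⟩ := exists_isTranscendenceBasis_superset hp.coe_range
  have := formallyEtale_adjoin_of_isTranscendenceBasis ht
  let A := Algebra.adjoin K (Set.range ((↑) : t → L))
  -- Basis elements outside the family `p` get derivative `0`; any value would do.
  let y : t → L := fun a => Function.extend p x 0 a
  let e : MvPolynomial t K ≃ₐ[K] A := ht.1.aevalEquiv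
  let : Module (MvPolynomial t K) L := Module.compHom L (e : MvPolynomial t K →+* A)
  have : IsScalarTower K (MvPolynomial t K) L := by
    refine ⟨fun a f z => ?_⟩
    change (e (a • f)) • z = a • (e f • z)
    rw [map_smul, smul_assoc]
  let δ₀ : Derivation K (MvPolynomial t K) L := mkDerivation K y
  let δ : Derivation K A L := Derivation.mk' (δ₀.toLinearMap ∘ₗ e.symm.toLinearMap) (by
    intro a b
    change δ₀ (e.symm (a * b)) = a • δ₀ (e.symm b) + b • δ₀ (e.symm a)
    rw [map_mul, Derivation.leibniz]
    change e (e.symm a) • δ₀ (e.symm b) + e (e.symm b) • δ₀ (e.symm a) = _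
    rw [e.apply_symm_apply, e.apply_symm_apply])
  obtain ⟨D, hD⟩ := exists_derivation_extending δ
  refine ⟨D, fun i => ?_⟩
  have hi : p i ∈ t := hst ⟨i, rfl⟩
  have h1 : algebraMap A L (e (X ⟨p i, hi⟩)) = p i := by
    simp [e, A]
  calc D (p i) = D (algebraMap A L (e (X ⟨p i, hi⟩))) := by rw [h1]
    _ = δ₀ (e.symm (e (X ⟨p i, hi⟩))) := hD _
    _ = y ⟨p i, hi⟩ := by rw [e.symm_apply_apply]; exact mkDerivation_X K y _
    _ = x i := hp.injective.extend_apply x 0 i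

end Derivations

/-! ### Generic rank and left kernels. -/

section Rank

theorem exists_linearIndependent_cols {m n : Type*} [Fintype m] [Fintype n] (A : Matrix m n ℝ) :
    ∃ s : Fin A.rank → n, LinearIndependent ℝ (A.submatrix id s).col := by
  rw [rank_eq_finrank_span_cols]
  obtain ⟨f, hf, -, hfi⟩ := Submodule.exists_fun_fin_finrank_span_eq ℝ (Set.range A.col)
  choose s hs using hf
  refine ⟨s, ?_⟩
  rwa [show (A.submatrix id s).col = f from funext hs]

/-- A matrix of polynomials attains its maximal rank at every algebraically independent point. -/
theorem rank_map_aeval_le {σ m n : Type*} [Fintype m] [Fintype n]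
    {p : σ → ℝ} (hp : AlgebraicIndependent ℚ p) (q : σ → ℝ)
    (M : Matrix m n (MvPolynomial σ ℚ)) :
    (M.map (aeval q)).rank ≤ (M.map (aeval p)).rank := by
  obtain ⟨s, hs⟩ := exists_linearIndependent_cols (M.map (aeval q))
  let N := M.submatrix id s
  -- The Gram determinant of the columns independent at `q` is one rational polynomial. Over `ℝ` it
  -- is nonzero at `q`, so it is a nonzero polynomial and cannot vanish at `p`.
  have key : ∀ z : σ → ℝ, ((N.map (aeval z))ᵀ * N.map (aeval z)).det = aeval z (Nᵀ * N).det := by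
    intro z
    rw [AlgHom.map_det]
    congr 1
    ext i j
    simp [Matrix.mul_apply]
  have hq : ((N.map (aeval q))ᵀ * N.map (aeval q)).det ≠ 0 := by
    intro h0
    obtain ⟨v, hv, hv0⟩ := Matrix.exists_mulVec_eq_zero_iff.2 h0
    have h1 : N.map (aeval q) *ᵥ v = 0 := by
      have := congrArg (v ⬝ᵥ ·) hv0
      simp only [dotProduct_zero] at this
      rw [← Matrix.mulVec_mulVec, Matrix.dotProduct_mulVec, Matrix.vecMul_transpose] at this
      exact dotProduct_self_eq_zero.1 this
    exact hv (Matrix.mulVec_injective_iff.2 hs (by rw [mulVec_zero]; exact h1))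
  have hP : (Nᵀ * N).det ≠ 0 := by
    intro h0
    rw [key, h0, map_zero] at hq
    exact hq rfl
  have hdet : ((N.map (aeval p))ᵀ * N.map (aeval p)).det ≠ 0 := by
    rw [key]
    exact fun h => hP ((algebraicIndependent_iff.1 hp) _ h)
  calc (M.map (aeval q)).rank = ((N.map (aeval p))ᵀ * N.map (aeval p)).rank := by
        rw [rank_of_det_ne_zero hdet, Fintype.card_fin]
    _ ≤ (N.map (aeval p)).rank := rank_mul_le_right _ _
    _ ≤ (M.map (aeval p)).rank := rank_submatrix_le (M.map (aeval p)) id s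

theorem mem_kerTranspose_iff {m n : Type*} [Fintype m] {A : Matrix m n ℝ} {y : m → ℝ} :
    y ∈ kerTranspose A ↔ ∀ j, ∑ e, A e j * y e = 0 := by
  rw [LinearMap.mem_ker, mulVecLin_apply, funext_iff]
  rfl

/-- The left kernel is the annihilator of the column space: `h` gives one inclusion, and the rank
bound makes the dimensions agree. -/
theorem kerTranspose_eq_of_range_le {m n : Type*} [Fintype m] [Fintype n] {A B : Matrix m n ℝ}
    (h : ∀ x, ∃ z, A *ᵥ x = B *ᵥ z) (hr : B.rank ≤ A.rank) :
    kerTranspose A = kerTranspose B := by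
  classical
  symm
  apply Submodule.eq_of_le_of_finrank_le
  · intro y hy
    rw [LinearMap.mem_ker, mulVecLin_apply] at hy ⊢
    rw [mulVec_transpose] at hy ⊢
    refine dotProduct_eq_zero _ fun x => ?_
    obtain ⟨z, hz⟩ := h x
    rw [← dotProduct_mulVec, hz, dotProduct_mulVec, hy, zero_dotProduct]
  · have hA := LinearMap.finrank_range_add_finrank_ker (Aᵀ.mulVecLin)
    have hB := LinearMap.finrank_range_add_finrank_ker (Bᵀ.mulVecLin)
    have hA' : Module.finrank ℝ (LinearMap.range Aᵀ.mulVecLin) = A.rank := A.rank_transpose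
    have hB' : Module.finrank ℝ (LinearMap.range Bᵀ.mulVecLin) = B.rank := B.rank_transpose
    unfold kerTranspose
    omega

end Rank

/-! ### Rigidity and dilation matrices of equivalent frameworks. -/

section Frameworks

theorem Equivalent.sum_sq_eq {V : Type*} {d : ℕ} {G : SimpleGraph V}
    {p q : Realisation V d} (h : Equivalent G p q) {v w : V} (hvw : G.Adj v w) :
    ∑ i, (p v i - p w i) ^ 2 = ∑ i, (q v i - q w i) ^ 2 := by
  have := congrArg (· ^ 2) (h v w hvw)
  simpa [EuclideanSpace.norm_sq_eq] using this

/-- Differentiating the equality of the squared edge lengths. -/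
theorem Equivalent.sum_mul_derivation_eq {V : Type*} {d : ℕ} {G : SimpleGraph V}
    {p q : Realisation V d} (h : Equivalent G p q) (D : Derivation ℚ ℝ ℝ) {v w : V}
    (hvw : G.Adj v w) :
    ∑ i, (p v i - p w i) * (D (p v i) - D (p w i)) =
      ∑ i, (q v i - q w i) * (D (q v i) - D (q w i)) := by
  have h1 : ∀ r : Realisation V d, D (∑ i, (r v i - r w i) ^ 2) =
      2 * ∑ i, (r v i - r w i) * (D (r v i) - D (r w i)) := by
    intro r
    rw [map_sum, Finset.mul_sum]
    refine Finset.sum_congr rfl fun i _ => ?_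
    rw [sq, Derivation.leibniz, map_sub, smul_eq_mul]
    ring
  have h2 := congrArg D (h.sum_sq_eq hvw)
  rw [h1, h1] at h2
  linarith

variable {V : Type*} [Fintype V] [DecidableEq V]

theorem rigidityMatrix_mulVec {m : ℕ} (G : SimpleGraph V) (p : Realisation V m)
    (x : V × Fin m → ℝ) {v w : V} (h : s(v, w) ∈ G.edgeSet) :
    (rigidityMatrix G p *ᵥ x) ⟨s(v, w), h⟩ = ∑ j, (p v j - p w j) * (x (v, j) - x (w, j)) := by
  simp only [mulVec, dotProduct, rigidityMatrix, of_apply, Sym2.lift_mk, Fintype.sum_prod_type_right,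
    add_mul, ite_mul, zero_mul, Finset.sum_add_distrib, Finset.sum_ite_eq', Finset.mem_univ, if_true]
  rw [← Finset.sum_add_distrib]
  exact Finset.sum_congr rfl fun j _ => by ring

theorem sum_eq_sum_castLE_add_sum_dilCoord {d : ℕ} (k : ℕ) (f : Fin d → ℝ) :
    ∑ i, f i = ∑ j : Fin (d - k), f (Fin.castLE (Nat.sub_le d k) j) + ∑ i : DilCoord d k, f i := by
  rw [← Fintype.sum_subtype_add_sum_subtype (fun i : Fin d => (i : ℕ) < d - k) f]
  congr 1
  · symm
    refine Fintype.sum_equiv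
      ⟨fun j => ⟨Fin.castLE (Nat.sub_le d k) j, j.2⟩, fun i => ⟨i.1, i.2⟩, fun _ => rfl,
        fun _ => rfl⟩ _ _ fun _ => rfl
  · exact Fintype.sum_equiv (Equiv.subtypeEquivRight fun i => by simp) _ _ fun _ => rfl

theorem dilRigidityMatrix_mulVec {d k : ℕ} (G : SimpleGraph V) (p : Realisation V d)
    (x : V × Fin (d - k) → ℝ) (c : DilCoord d k → ℝ) {v w : V} (h : s(v, w) ∈ G.edgeSet) :
    (dilRigidityMatrix k G p *ᵥ Sum.elim x c) ⟨s(v, w), h⟩ =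
      ∑ j, (proj k p v j - proj k p w j) * (x (v, j) - x (w, j)) +
        ∑ i : DilCoord d k, (p v i - p w i) ^ 2 * c i := by
  rw [dilRigidityMatrix, fromCols_mulVec, Pi.add_apply, Sum.elim_comp_inl, Sum.elim_comp_inr,
    rigidityMatrix_mulVec]
  rfl

theorem dilationMatrix_mulVec {d k : ℕ} (v₀ : V) (p : Realisation V d) (x : V × Fin d → ℝ)
    (v : {v : V // v ≠ v₀}) (i : DilCoord d k) :
    (dilationMatrix k v₀ p *ᵥ x) (v, i) =
      1 / p v₀ i * x (v, i) - p v i / p v₀ i ^ 2 * x (v₀, i) := by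
  have hv := v.2
  have h : ∀ u : V, (if u = (v : V) then 1 / p v₀ i
      else if u = v₀ then -p v i / (p v₀ i) ^ 2 else 0) * x (u, i) =
      (if u = (v : V) then 1 / p v₀ i * x (u, i) else 0) +
      (if u = v₀ then -p v i / (p v₀ i) ^ 2 * x (u, i) else 0) := by
    intro u
    by_cases h1 : u = v
    · subst h1; simp [hv]
    · simp [h1]
  have hu : ∀ u : V, ∑ j, dilationMatrix k v₀ p (v, i) (u, j) * x (u, j) =
      (if u = (v : V) then 1 / p v₀ i * x (u, i) else 0) +
      (if u = v₀ then -p v i / (p v₀ i) ^ 2 * x (u, i) else 0) := by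
    intro u
    rw [← h u, Finset.sum_eq_single i.1 (fun j _ hj => by simp [dilationMatrix, hj]) (by simp)]
    simp [dilationMatrix]
  simp only [mulVec, dotProduct, Fintype.sum_prod_type, hu, Finset.sum_add_distrib,
    Finset.sum_ite_eq', Finset.mem_univ, if_true]
  ring

variable {d : ℕ} {k : ℕ} {G : SimpleGraph V} {p q : Realisation V d}

/-- The witness is `D ∘ q`. The dilation rows compute the derivative of the ratio `p v i / p v₀ i`,
which is the same for `q`, so the terms in `D α` cancel. -/
theorem exists_jacobian_mulVec_eq (hp : IsGeneric p) (h : DKEquivalent k G p q) (v₀ : V)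
    (x : V × Fin d → ℝ) : ∃ z, jacobian k v₀ G p *ᵥ x = jacobian k v₀ G q *ᵥ z := by
  obtain ⟨D, hD⟩ := exists_derivation_of_algebraicIndependent hp x
  refine ⟨fun y => D (q y.1 y.2), ?_⟩
  simp only [jacobian, fromRows_mulVec]
  congr 1
  · ext ⟨e, he⟩
    induction e with | _ v w =>
    rw [rigidityMatrix_mulVec, rigidityMatrix_mulVec, ← h.1.sum_mul_derivation_eq D he]
    simp only [← hD]
  · ext ⟨v, i⟩
    rw [dilationMatrix_mulVec, dilationMatrix_mulVec]
    obtain ⟨α, hα, hpq⟩ := h.2 i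
    have hp0 : p v₀ i ≠ 0 := hp.ne_zero (v₀, i.1)
    have hq0 : q v₀ i ≠ 0 := by
      intro h0
      rw [hpq, h0, mul_zero] at hp0
      exact hp0 rfl
    rw [← hD (v, i), ← hD (v₀, i)]
    simp only [hpq, Derivation.leibniz, smul_eq_mul]
    field_simp
    ring

theorem exists_dilRigidityMatrix_mulVec_eq (hp : IsGeneric p) (h : DKEquivalent k G p q)
    (x : (V × Fin (d - k)) ⊕ DilCoord d k → ℝ) :
    ∃ z, dilRigidityMatrix k G p *ᵥ x = dilRigidityMatrix k G q *ᵥ z := by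
  -- In a dilated coordinate the velocity is proportional to position, so an edge contributes a
  -- multiple of its squared length there, as in the extra column. For `q` the factor shifts by `D
  -- (α i) / α i`, since `α i` need not be a constant of `D`.
  obtain ⟨D, hD⟩ := exists_derivation_of_algebraicIndependent hp
    (fun y => if hy : (y.2 : ℕ) < d - k then x (.inl (y.1, ⟨y.2, hy⟩))
      else x (.inr ⟨y.2, not_lt.1 hy⟩) * p y.1 y.2)
  choose α hα hpq using h.2
  have hDp : ∀ (v : V) (i : DilCoord d k), D (p v i) = x (.inr i) * p v i := fun v i => by
    rw [hD (v, i)]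
    exact dif_neg (not_lt.2 i.2)
  have hDq : ∀ (v : V) (i : DilCoord d k),
      D (q v i) = (x (.inr i) - D (α i) / α i) * q v i := fun v i => by
    have h1 := hDp v i
    rw [hpq, Derivation.leibniz, smul_eq_mul, smul_eq_mul] at h1
    have := hα i
    field_simp
    linarith
  refine ⟨Sum.elim (fun y => D (proj k q y.1 y.2)) fun i => x (.inr i) - D (α i) / α i, ?_⟩
  ext ⟨e, he⟩
  induction e with | _ v w =>
  have key := h.1.sum_mul_derivation_eq D he
  rw [sum_eq_sum_castLE_add_sum_dilCoord k fun i => (p v i - p w i) * (D (p v i) - D (p w i)),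
    sum_eq_sum_castLE_add_sum_dilCoord k fun i => (q v i - q w i) * (D (q v i) - D (q w i))] at key
  have hx : x = Sum.elim (x ∘ .inl) (x ∘ .inr) := (Sum.elim_comp_inl_inr x).symm
  rw [hx, dilRigidityMatrix_mulVec, dilRigidityMatrix_mulVec]
  convert key using 1
  · congr 1
    · refine Finset.sum_congr rfl fun j _ => ?_
      rw [hD (v, _), hD (w, _), dif_pos (by exact j.2), dif_pos (by exact j.2)]
      rfl
    · refine Finset.sum_congr rfl fun i _ => ?_
      rw [hDp, hDp, Function.comp_apply]
      ring
  · congr 1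
    refine Finset.sum_congr rfl fun i _ => ?_
    rw [hDq, hDq, ← hx]
    ring

/-! ### Maximal rank at generic points, and stresses. -/

variable [Fintype G.edgeSet]

theorem rank_dilRigidityMatrix_le (hp : IsGeneric p) (q : Realisation V d) :
    (dilRigidityMatrix k G q).rank ≤ (dilRigidityMatrix k G p).rank := by
  let M : Matrix G.edgeSet ((V × Fin (d - k)) ⊕ DilCoord d k) (MvPolynomial (V × Fin d) ℚ) :=
    Matrix.of fun e => Sum.elim
      (fun x => Sym2.lift ⟨fun v w : V =>
        (if x.1 = v then X (v, Fin.castLE (Nat.sub_le d k) x.2) -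
          X (w, Fin.castLE (Nat.sub_le d k) x.2) else 0) +
        (if x.1 = w then X (w, Fin.castLE (Nat.sub_le d k) x.2) -
          X (v, Fin.castLE (Nat.sub_le d k) x.2) else 0),
        fun _ _ => add_comm _ _⟩ e.1)
      (fun i => Sym2.lift ⟨fun v w : V => (X (v, i.1) - X (w, i.1)) ^ 2, fun v w => by ring⟩ e.1)
  have hM : ∀ r : Realisation V d,
      M.map (aeval fun x : V × Fin d => r x.1 x.2) = dilRigidityMatrix k G r := by
    intro r
    ext ⟨e, he⟩ x
    induction e with | _ v w =>
    rcases x with x | i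
    · simp [M, dilRigidityMatrix, rigidityMatrix, proj, apply_ite (aeval _)]
    · simp [M, dilRigidityMatrix, rigidityMap]
  have := rank_map_aeval_le hp (fun x : V × Fin d => q x.1 x.2) M
  rwa [hM, hM] at this

/-- The dilation rows are not polynomial; multiplying each by the nonzero `r v₀ i ^ 2` makes them so
without changing the rank. -/
theorem rank_jacobian_le (hp : IsGeneric p) {v₀ : V} (hq : ∀ i : DilCoord d k, q v₀ i ≠ 0) :
    (jacobian k v₀ G q).rank ≤ (jacobian k v₀ G p).rank := by
  let M : Matrix (G.edgeSet ⊕ ({v : V // v ≠ v₀} × DilCoord d k)) (V × Fin d)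
      (MvPolynomial (V × Fin d) ℚ) :=
    Matrix.of fun r x => Sum.elim
      (fun e : G.edgeSet => Sym2.lift ⟨fun v w : V =>
        (if x.1 = v then X (v, x.2) - X (w, x.2) else 0) +
        (if x.1 = w then X (w, x.2) - X (v, x.2) else 0), fun _ _ => add_comm _ _⟩ e.1)
      (fun r => if x.2 = r.2.1 then
        (if x.1 = r.1.1 then X (v₀, r.2.1) else if x.1 = v₀ then -X (r.1.1, r.2.1) else 0)
        else 0) r
  let c : Realisation V d → G.edgeSet ⊕ ({v : V // v ≠ v₀} × DilCoord d k) → ℝ :=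
    fun r => Sum.elim (fun _ => 1) fun y => 1 / r v₀ y.2 ^ 2
  have hM : ∀ r : Realisation V d, (∀ i : DilCoord d k, r v₀ i ≠ 0) →
      (jacobian k v₀ G r).rank = (M.map (aeval fun x : V × Fin d => r x.1 x.2)).rank := by
    intro r hr
    have h1 : jacobian k v₀ G r =
        diagonal (c r) * M.map (aeval fun x : V × Fin d => r x.1 x.2) := by
      ext y x
      rw [diagonal_mul]
      rcases y with ⟨e, he⟩ | ⟨v, i⟩
      · induction e with | _ v w =>
        simp [M, c, jacobian, rigidityMatrix, apply_ite (aeval _)]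
      · have := hr i
        simp only [M, c, jacobian, dilationMatrix, fromRows_apply_inr, of_apply, Sum.elim_inr,
          map_apply, apply_ite (aeval _), aeval_X, map_neg, map_zero, mul_ite, mul_zero]
        congr 2
        · field_simp
        · congr 1
          field_simp
    rw [h1]
    refine rank_mul_eq_right_of_isUnit_det _ _ ?_
    rw [det_diagonal, isUnit_iff_ne_zero, Finset.prod_ne_zero_iff]
    rintro (e | y) -
    · exact one_ne_zero
    · exact one_div_ne_zero (pow_ne_zero 2 (hr y.2))
  rw [hM q hq, hM p fun i => hp.ne_zero (v₀, i.1)]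
  exact rank_map_aeval_le hp _ M

theorem kerTranspose_dilRigidityMatrix_eq (hp : IsGeneric p) (h : DKEquivalent k G p q) :
    kerTranspose (dilRigidityMatrix k G p) = kerTranspose (dilRigidityMatrix k G q) :=
  kerTranspose_eq_of_range_le (exists_dilRigidityMatrix_mulVec_eq hp h)
    (rank_dilRigidityMatrix_le hp q)

theorem kerTranspose_jacobian_eq (hp : IsGeneric p) (h : DKEquivalent k G p q) (v₀ : V) :
    kerTranspose (jacobian k v₀ G p) = kerTranspose (jacobian k v₀ G q) := by
  refine kerTranspose_eq_of_range_le (exists_jacobian_mulVec_eq hp h v₀)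
    (rank_jacobian_le hp fun i h0 => ?_)
  obtain ⟨α, -, hpq⟩ := h.2 i
  exact hp.ne_zero (v₀, i.1) (by rw [hpq, h0, mul_zero])

/-- A column of the equilibrium condition of a stress, as a sum over the neighbours. -/
theorem sum_rigidityMatrix_mul [DecidableRel G.Adj] {m : ℕ} (p : Realisation V m)
    (σ : G.edgeSet → ℝ) (v : V) (j : Fin m) :
    ∑ e, rigidityMatrix G p e (v, j) * σ e =
      ∑ w : G.neighborSet v, σ ⟨s(v, w.1), G.mem_edgeSet.mpr w.2⟩ * (p v j - p w.1 j) := by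
  symm
  refine Fintype.sum_of_injective
    (fun w : G.neighborSet v => (⟨s(v, w.1), G.mem_edgeSet.mpr w.2⟩ : G.edgeSet)) ?_ _ _ ?_ ?_
  · intro w₁ w₂ h
    exact Subtype.ext (Sym2.congr_right.1 (congrArg Subtype.val h))
  · rintro ⟨e, he⟩ hr
    induction e with | _ a b =>
    have ha : v ≠ a := by
      rintro rfl
      exact hr ⟨⟨b, he⟩, rfl⟩
    have hb : v ≠ b := by
      rintro rfl
      exact hr ⟨⟨a, SimpleGraph.Adj.symm he⟩, Subtype.ext Sym2.eq_swap⟩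
    simp [rigidityMatrix, ha, hb]
  · intro w
    have hw : v ≠ w := G.ne_of_adj w.2
    simp [rigidityMatrix, hw, mul_comm]

omit [Fintype G.edgeSet] in
theorem sum_dilationMatrix_mul_of_ne {v₀ : V} (p : Realisation V d)
    (l : {v : V // v ≠ v₀} × DilCoord d k → ℝ) {v : V} (hv : v ≠ v₀) (i : DilCoord d k) :
    ∑ r, dilationMatrix k v₀ p r (v, i) * l r = 1 / p v₀ i * l (⟨v, hv⟩, i) := by
  rw [Finset.sum_eq_single (⟨v, hv⟩, i)]
  · simp [dilationMatrix]
  · rintro ⟨u, j⟩ - h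
    by_cases hj : i = j
    · subst hj
      have : v ≠ u := by
        rintro rfl
        exact h rfl
      simp [dilationMatrix, this, hv]
    · simp [dilationMatrix, Subtype.coe_inj, hj]
  · simp

omit [Fintype G.edgeSet] in
theorem sum_dilationMatrix_mul_self (v₀ : V) (p : Realisation V d)
    (l : {v : V // v ≠ v₀} × DilCoord d k → ℝ) (i : DilCoord d k) :
    ∑ r, dilationMatrix k v₀ p r (v₀, i) * l r =
      ∑ u : {v : V // v ≠ v₀}, -p u i / p v₀ i ^ 2 * l (u, i) := by
  rw [Fintype.sum_prod_type]
  refine Finset.sum_congr rfl fun u _ => ?_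
  rw [Finset.sum_eq_single i]
  · simp [dilationMatrix, u.2.symm]
  · intro j _ hj
    simp [dilationMatrix, Subtype.coe_inj, hj.symm]
  · simp

omit [Fintype V] in
theorem sum_rigidityMatrix_proj_mul_eq_zero {σ : G.edgeSet → ℝ}
    (hσ : σ ∈ kerTranspose (dilRigidityMatrix k G p)) (v : V) {j : Fin d} (hj : (j : ℕ) < d - k) :
    ∑ e, rigidityMatrix G p e (v, j) * σ e = 0 := by
  refine Eq.trans (Finset.sum_congr rfl ?_) (mem_kerTranspose_iff.1 hσ (.inl (v, ⟨j, hj⟩)))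
  rintro ⟨e, he⟩ -
  congr 1

/-- The energy of a stress in a dilated coordinate vanishes. -/
theorem sum_mul_sum_rigidityMatrix_mul_eq_zero {σ : G.edgeSet → ℝ}
    (hσ : σ ∈ kerTranspose (dilRigidityMatrix k G p)) (i : DilCoord d k) :
    ∑ v, p v i * ∑ e, rigidityMatrix G p e (v, i) * σ e = 0 := by
  rw [← mem_kerTranspose_iff.1 hσ (.inr i)]
  simp only [Finset.mul_sum]
  rw [Finset.sum_comm]
  refine Finset.sum_congr rfl ?_
  rintro ⟨e, he⟩ -
  induction e with | _ v w =>
  -- Pairing an edge row with the `i`-th coordinate of `p` itself yields the squared edge length in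
  -- that coordinate.
  have h := rigidityMatrix_mulVec G p (fun x => if x.2 = i.1 then p x.1 i else 0) he
  simp only [mulVec, dotProduct, Fintype.sum_prod_type, mul_ite, mul_zero, Finset.sum_ite_eq',
    Finset.mem_univ, if_true] at h
  rw [Finset.sum_eq_single i.1 (fun j _ hj => by simp [hj]) (by simp), if_pos rfl, if_pos rfl] at h
  have h2 : dilRigidityMatrix k G p ⟨s(v, w), he⟩ (.inr i) = (p v i - p w i) ^ 2 := rfl
  rw [h2, sq, ← h, Finset.sum_mul]
  exact Finset.sum_congr rfl fun u _ => by ring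

/-- A stress annihilating the dilation-rigidity matrix extends to a cokernel vector of the
Jacobian. -/
theorem sumElim_mem_kerTranspose_jacobian {σ : G.edgeSet → ℝ}
    (hσ : σ ∈ kerTranspose (dilRigidityMatrix k G p)) {v₀ : V}
    (hv₀ : ∀ i : DilCoord d k, p v₀ i ≠ 0) :
    Sum.elim σ (fun r : {v : V // v ≠ v₀} × DilCoord d k =>
      -(p v₀ r.2 * ∑ e, rigidityMatrix G p e (r.1.1, r.2.1) * σ e)) ∈
        kerTranspose (jacobian k v₀ G p) := by
  -- The multipliers are forced by the dilated columns at `v ≠ v₀`; the columns at `v₀` then close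
  -- because the energy vanishes.
  rw [mem_kerTranspose_iff]
  rintro ⟨v, j⟩
  simp only [Fintype.sum_sum_type, jacobian, fromRows_apply_inl, fromRows_apply_inr, Sum.elim_inl,
    Sum.elim_inr]
  by_cases hj : (j : ℕ) < d - k
  · rw [sum_rigidityMatrix_proj_mul_eq_zero hσ v hj, zero_add]
    refine Finset.sum_eq_zero fun r _ => ?_
    have : j ≠ r.2.1 := by
      rintro rfl
      exact absurd r.2.2 (not_le.2 hj)
    simp [dilationMatrix, this]
  · obtain ⟨i, rfl⟩ : ∃ i : DilCoord d k, i.1 = j := ⟨⟨j, not_lt.1 hj⟩, rfl⟩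
    have h0 := hv₀ i
    by_cases hv : v = v₀
    · subst hv
      rw [sum_dilationMatrix_mul_self]
      have key := sum_mul_sum_rigidityMatrix_mul_eq_zero hσ i
      rw [Fintype.sum_eq_add_sum_subtype_ne _ v] at key
      have h1 : ∀ u : {u : V // u ≠ v}, -p u i / p v i ^ 2 *
          -(p v i * ∑ e, rigidityMatrix G p e (u.1, i.1) * σ e) =
          (p u i * ∑ e, rigidityMatrix G p e (u.1, i.1) * σ e) / p v i := by
        intro u
        field_simp
      simp only [h1, ← Finset.sum_div]
      field_simp
      linear_combination key
    · rw [sum_dilationMatrix_mul_of_ne _ _ hv]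
      field_simp
      ring

/-- With `S` the sum, column `(v, i)` at `q` reads `α * S - S / α = 0`: the multiplier built at `p`
carries `p v₀ i`, while the matrix entry is `1 / (α * p v₀ i)`. -/
theorem one_sub_sq_mul_sum_eq_zero (hp : IsGeneric p) (h : DKEquivalent k G p q)
    {σ : G.edgeSet → ℝ} (hσ : σ ∈ kerTranspose (dilRigidityMatrix k G p)) {i : DilCoord d k} {α : ℝ}
    (hα : ∀ v, q v i = α * p v i) {v v₀ : V} (hv : v ≠ v₀) :
    (1 - α ^ 2) * ∑ e, rigidityMatrix G p e (v, i.1) * σ e = 0 := by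
  have hp0 : ∀ i : DilCoord d k, p v₀ i ≠ 0 := fun i => hp.ne_zero (v₀, i.1)
  have hα0 : α ≠ 0 := by
    rintro rfl
    obtain ⟨β, -, hβ⟩ := h.2 i
    exact hp0 i (by rw [hβ, hα, zero_mul, mul_zero])
  have hJ := sumElim_mem_kerTranspose_jacobian hσ hp0
  rw [kerTranspose_jacobian_eq hp h, mem_kerTranspose_iff] at hJ
  have hvi := hJ (v, i.1)
  simp only [Fintype.sum_sum_type, jacobian, fromRows_apply_inl, fromRows_apply_inr, Sum.elim_inl,
    Sum.elim_inr] at hvi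
  have hq : ∑ e, rigidityMatrix G q e (v, i.1) * σ e =
      α * ∑ e, rigidityMatrix G p e (v, i.1) * σ e := by
    rw [Finset.mul_sum]
    refine Finset.sum_congr rfl ?_
    rintro ⟨e, he⟩ -
    induction e with | _ a b =>
    simp only [rigidityMatrix, of_apply, Sym2.lift_mk, hα]
    split_ifs <;> ring
  rw [sum_dilationMatrix_mul_of_ne _ _ hv, hq, hα] at hvi
  have h0 := hp0 i
  field_simp at hvi
  linear_combination -hvi

end Frameworks

end DilationRigidity

theorem lemmal {V : Type*} [Fintype V] [DecidableEq V] (G : SimpleGraph V) [DecidableRel G.Adj]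
    (d k : ℕ) (hk : 1 ≤ k) (hkd : k < d)
    (p q : DilationRigidity.Realisation V d)
    (hgen : DilationRigidity.IsGeneric p)
    (hrigid : DilationRigidity.IsDKRigid k G p)
    (hequiv : DilationRigidity.DKEquivalent k G p q) :
    DilationRigidity.kerTranspose (DilationRigidity.dilRigidityMatrix k G p) =
        DilationRigidity.kerTranspose (DilationRigidity.dilRigidityMatrix k G q) ∧
    (∀ v₀ : V,
      DilationRigidity.kerTranspose (DilationRigidity.jacobian k v₀ G p) =
        DilationRigidity.kerTranspose (DilationRigidity.jacobian k v₀ G q)) ∧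
    (∀ σ ∈ DilationRigidity.kerTranspose (DilationRigidity.dilRigidityMatrix k G p),
      ∀ (i : DilationRigidity.DilCoord d k) (α : ℝ), (∀ v : V, q v i = α * p v i) →
        ∀ v : V,
          (1 - α ^ 2) *
            ∑ w : G.neighborSet v,
              σ ⟨s(v, w.1), G.mem_edgeSet.mpr w.2⟩ * (p v i - p w.1 i) = 0) := by
  refine ⟨DilationRigidity.kerTranspose_dilRigidityMatrix_eq hgen hequiv,
    DilationRigidity.kerTranspose_jacobian_eq hgen hequiv, fun σ hσ i α hα v => ?_⟩
  -- The base vertex must differ from `v`; if there is no other vertex, `v` has no neighbours.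
  by_cases hv : ∃ v₀, v ≠ v₀
  · obtain ⟨v₀, hv₀⟩ := hv
    rw [← DilationRigidity.sum_rigidityMatrix_mul]
    exact DilationRigidity.one_sub_sq_mul_sum_eq_zero hgen hequiv hσ hα hv₀
  · have : IsEmpty (G.neighborSet v) := ⟨fun w => hv ⟨w, G.ne_of_adj w.2⟩⟩
    rw [Fintype.sum_empty, mul_zero]
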